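/- Consider a slotted-time network of $N$ users sharing one contention domain. In slot $t\in\{0,1,2,\dots\}$ user $n$ receives an amount $A_n(t)\ge 0$ of data and has channel rate $R_n(t)$; the queues evolve from an arbitrary nonnegative initial queue vector by $$Q_n(t+1)=\big[Q_n(t)+A_n(t)-R_n(t)I_n(t)\big]^+ ,$$ where $I_n(t)\in\{0,1\}$ indicates whether user $n$ is scheduled and at most one user is scheduled per slot. The channel rates take values in a fixed finite set, their distribution for user $n$ does not depend on $t$; the arrivals of user $n$ are identically distributed over time with mean $\lambda_n$ and finite second moment; all the variables $A_n(t),R_n(t)$ are independent across users and slots and of each other. The network is called stable if $$\limsup_{T\to\infty}\frac1T\sum_{t=0}^{T-1}\mathbb E\Big[\sum_{n}Q_n(t)\Big]<\infty .$$ The capacity region (for the given channel distributions) is the set of vectors $\lambda$ such that, for some arrival process with mean vector $\lambda$ as above, some scheduling rule (randomized, history-dependent, or even non-causal) makes the network stable; a vector $\lambda$ is strictly inside a set of vectors if some member of this set is larger than $\lambda$ in every coordinate. Fix $b>1$ and put $f(x)=b^x$. Under the policy DMW-AB, in every slot $t$ each user $n$ draws an exponential back-off time $X_n(t)$ with rate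 $f(w_n(t))$, where $w_n(t)=Q_n(t)R_n(t)$, using randomness that is independent across users and slots and of the arrivals and channels, and the user whose back-off time is the smallest transmits. **Theorem.** Suppose that there is $R_{\min}>0$ with $R_n(t)\ge R_{\min}$ almost surely for all $n,t$. Then, for every $b>1$, DMW-AB is throughput-optimal: for every $\lambda$ strictly inside the capacity region, every arrival process with mean vector $\lambda$ as above and every initial queue vector, the network is stable under DMW-AB. In particular, this holds for every $\lambda$ strictly inside the set of arrival rate vectors that the centralized Max-Weight policy (which schedules in each slot a user maximizing $w_n(t)$) stabilizes for some arrival process. -/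

import Mathlib

open MeasureTheory ProbabilityTheory Filter
open scoped ENNReal

universe u

noncomputable section

namespace Wireless

/-- The exogenous randomness of a network of `N` users on a probability space `(Ω, P)`:
`A n t` is the amount of data arriving to user `n` in slot `t`, `R n t` is the rate of the channel
of user `n` in slot `t`.  The arrivals are nonnegative, have a finite second moment, are identically
distributed over time with mean `lam n`; the channel rate of user `n` has law `channel n` in every
slot; all the variables `A n t`, `R n t` (over all users and slots) are mutually independent. -/
structure IsTraffic {N : ℕ} {Ω : Type*} [MeasurableSpace Ω] (P : Measure Ω)
    (channel : Fin N → Measure ℝ) (lam : Fin N → ℝ) (A R : Fin N → ℕ → Ω → ℝ) : Prop where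
  measurable_arrival : ∀ n t, Measurable (A n t)
  measurable_rate : ∀ n t, Measurable (R n t)
  arrival_nonneg : ∀ n t, ∀ᵐ ω ∂P, 0 ≤ A n t ω
  arrival_memLp : ∀ n t, MemLp (A n t) 2 P
  arrival_stationary : ∀ n t, IdentDistrib (A n t) (A n 0) P P
  arrival_mean : ∀ n t, ∫ ω, A n t ω ∂P = lam n
  rate_law : ∀ n t, HasLaw (R n t) (channel n) P
  indep : iIndepFun (Sum.elim (fun i : Fin N × ℕ => A i.1 i.2)
    (fun i : Fin N × ℕ => R i.1 i.2)) P

/-- A scheduling rule: `I n t` is `1` if user `n` is scheduled in slot `t` and `0` otherwise, and at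
most one user is scheduled in each slot.  The decision may be random and may depend in any
way on the queues, the arrivals and the channels; not even causality is required. -/
structure IsSchedule {N : ℕ} {Ω : Type*} [MeasurableSpace Ω] (I : Fin N → ℕ → Ω → ℝ) : Prop where
  measurable : ∀ n t, Measurable (I n t)
  zero_or_one : ∀ n t ω, I n t ω = 0 ∨ I n t ω = 1
  sum_le_one : ∀ t ω, ∑ n, I n t ω ≤ 1

/-- `Q` is the queue length process started from the queue lengths `q₀`:
`Q n (t+1) = [Q n t + A n t - R n t * I n t]⁺`. -/
structure IsQueue {N : ℕ} {Ω : Type*} (q₀ : Fin N → ℝ) (A R I Q : Fin N → ℕ → Ω → ℝ) :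
    Prop where
  init_nonneg : ∀ n, 0 ≤ q₀ n
  init : ∀ n ω, Q n 0 ω = q₀ n
  step : ∀ n t ω, Q n (t + 1) ω = max (Q n t ω + A n t ω - R n t ω * I n t ω) 0

/-- Stability (in the mean) of the network: the long-run time average of the expected total queue
length is finite, `limsup_T (1/T) ∑_{t<T} E[∑_n Q n t] < ∞`. -/
def Stable {N : ℕ} {Ω : Type*} [MeasurableSpace Ω] (P : Measure Ω) (Q : Fin N → ℕ → Ω → ℝ) :
    Prop :=
  limsup (fun T : ℕ =>
    (∑ t ∈ Finset.range T, ∫⁻ ω, ENNReal.ofReal (∑ n, Q n t ω) ∂P) / (T : ℝ≥0∞)) atTop < ∞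

/-- The weighted rate `w n t = Q n t * R n t` of user `n` in slot `t`. -/
def weight {N : ℕ} {Ω : Type*} (Q R : Fin N → ℕ → Ω → ℝ) (n : Fin N) (t : ℕ) (ω : Ω) : ℝ :=
  Q n t ω * R n t ω

/-- The centralized Max-Weight policy: in every slot exactly one user is scheduled, and its
weighted rate is maximal (ties are broken in an arbitrary way). -/
structure IsMaxWeight {N : ℕ} {Ω : Type*} (Q R I : Fin N → ℕ → Ω → ℝ) : Prop where
  maximal : ∀ n t ω, I n t ω = 1 → ∀ m, weight Q R m t ω ≤ weight Q R n t ω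
  sum_eq_one : 0 < N → ∀ t ω, ∑ n, I n t ω = 1

/-- The capacity region of the channel: the arrival rate vectors for which the network can be
stabilized by some scheduling rule. -/
def capacityRegion {N : ℕ} (channel : Fin N → Measure ℝ) : Set (Fin N → ℝ) :=
  {lam | ∃ (Ω : Type) (_ : MeasurableSpace Ω) (P : Measure Ω) (_ : IsProbabilityMeasure P)
    (q₀ : Fin N → ℝ) (A R I Q : Fin N → ℕ → Ω → ℝ),
    IsTraffic P channel lam A R ∧ IsSchedule I ∧ IsQueue q₀ A R I Q ∧ Stable P Q}

/-- The arrival rate vectors for which the network can be stabilized by Max-Weight. -/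
def maxWeightRegion {N : ℕ} (channel : Fin N → Measure ℝ) : Set (Fin N → ℝ) :=
  {lam | ∃ (Ω : Type) (_ : MeasurableSpace Ω) (P : Measure Ω) (_ : IsProbabilityMeasure P)
    (q₀ : Fin N → ℝ) (A R I Q : Fin N → ℕ → Ω → ℝ),
    IsTraffic P channel lam A R ∧ IsSchedule I ∧ IsQueue q₀ A R I Q ∧ IsMaxWeight Q R I ∧
      Stable P Q}

/-- `lam` lies strictly inside the region `S`: some vector of `S` is strictly larger than `lam` in
every coordinate. -/
def StrictlyInside {N : ℕ} (S : Set (Fin N → ℝ)) (lam : Fin N → ℝ) : Prop :=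
  ∃ mu ∈ S, ∀ n, lam n < mu n

/-- The distributed policy DMW-AB with rate function `f`.  In slot `t` user `n` draws a back-off
time `X n t`, exponential with rate `f (w n t)`: the normalized times `f (w n t) * X n t` are
standard exponential variables, independent of each other (over users and slots) and of all the
arrivals and channel rates.  Equivalently, for positive `f`, given the earlier back-off times and all
the arrivals and channel rates, the `X n t` are independent exponentials with rates `f (w n t)`.
User `n` transmits when its back-off time expires first (ties have probability zero). -/
structure IsDMWAB {N : ℕ} {Ω : Type*} [MeasurableSpace Ω] (f : ℝ → ℝ) (P : Measure Ω)
    (A R X I Q : Fin N → ℕ → Ω → ℝ) : Prop where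
  measurable_backoff : ∀ n t, Measurable (X n t)
  backoff_law : ∀ n t, HasLaw (fun ω => f (weight Q R n t ω) * X n t ω) (expMeasure 1) P
  indep : iIndepFun (Sum.elim (fun i : Fin N × ℕ => A i.1 i.2)
    (Sum.elim (fun i : Fin N × ℕ => R i.1 i.2)
      (fun i : Fin N × ℕ => fun ω => f (weight Q R i.1 i.2 ω) * X i.1 i.2 ω))) P
  scheduled : ∀ n t ω, (∀ m, m ≠ n → X n t ω < X m t ω) → I n t ω = 1
  silent : ∀ n t ω, ¬ (∀ m, m ≠ n → X n t ω < X m t ω) → I n t ω = 0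

/-- DMW-AB with rate function `f` stabilizes the arrival rate vector `lam`: the network is stable
for every arrival process with mean vector `lam` and for every initial queue vector. -/
def DMWABStabilizes {N : ℕ} (f : ℝ → ℝ) (channel : Fin N → Measure ℝ) (lam : Fin N → ℝ) :
    Prop :=
  ∀ (Ω : Type u) [MeasurableSpace Ω] (P : Measure Ω) [IsProbabilityMeasure P]
    (q₀ : Fin N → ℝ) (A R X I Q : Fin N → ℕ → Ω → ℝ),
    IsTraffic P channel lam A R → IsDMWAB f P A R X I Q → IsQueue q₀ A R I Q → Stable P Q

end Wireless

end

/-!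
The proof compares DMW-AB with the largest weight available in each slot through the quadratic
Lyapunov function `∑ n, Q n t ^ 2`.

Write `M q = E[max_n q n * r n]`, where `r` is a vector of independent channel rates
(`expectedMaxWeight`). No rule, causal or not, can serve more than `max_n q n * R n t` of the
`q`-weighted backlog in a slot. If `∑ q n * mu n > M q` for some nonnegative `q`, the expected
backlog therefore grows linearly under every rule, so `mu` is outside the capacity region. Hence
`∑ q n * mu n ≤ M q` for every `mu` in the region and every `q ≥ 0`
(`sum_mul_le_expectedMaxWeight`).

The back-off time of user `n` is `Y n / b ^ w n` with `Y n` a standard exponential variable, so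
its logarithm to base `b` is `logb b (Y n) - w n`. The user with the smallest back-off time
consequently has weight at least `max_m w m - 2 * ∑ k, |logb b (Y k)|` (`norm_weight_le`), and
the error has a finite expectation that does not depend on the queues. Ties have probability
zero, since `Y n` has no atoms and is independent of the weights and of the other back-off times
(`ae_backoff_ne`).

The queues of slot `t` are a function of the variables of earlier slots, hence independent of
the arrivals and channel rates of slot `t`. For `lam` strictly below `mu` these facts give the
drift bound `E ∑ Q (t+1) ^ 2 - E ∑ Q t ^ 2 ≤ B - 2 * ∑ n, (mu n - lam n) * E (Q n t)`
(`drift_bound`), and telescoping it bounds the time averages of the expected backlog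
(`limsup_lt_top_of_drift`).
-/

namespace Wireless

variable {N : ℕ} {Ω : Type*}

/-! ### Exponential and independent variables -/

lemma ae_pos_expMeasure : ∀ᵐ y ∂(expMeasure 1), 0 < y := by
  have hm : Measurable (gammaPDF 1 1) := (measurable_gammaPDFReal 1 1).ennreal_ofReal
  unfold expMeasure gammaMeasure
  rw [ae_withDensity_iff hm]
  filter_upwards [Measure.ae_ne volume (0 : ℝ)] with y hy0 hy
  by_contra h
  exact hy (gammaPDF_of_neg (lt_of_le_of_ne (not_lt.1 h) hy0))

lemma expMeasure_singleton (x : ℝ) : expMeasure 1 {x} = 0 :=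
  withDensity_absolutelyContinuous _ _ (measure_singleton x)

lemma integrable_log_expMeasure : Integrable Real.log (expMeasure 1) := by
  have hmeas : Measurable (exponentialPDFReal 1) := measurable_exponentialPDFReal 1
  have hset : Integrable (fun y : ℝ => exponentialPDFReal 1 y * Real.log y) := by
    have hzero : ∀ y ∉ Set.Ioi (0 : ℝ), exponentialPDFReal 1 y * Real.log y = 0 := by
      intro y hy
      rcases (not_lt.1 (show ¬ 0 < y from hy)).lt_or_eq with h | h
      · simp [exponentialPDFReal, gammaPDFReal, not_le.2 h]
      · simp [h]
    rw [← integrableOn_iff_integrable_of_support_subset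
      (Function.support_subset_iff'.2 hzero)]
    have h1 := (Real.GammaIntegral_convergent (s := 3 / 2) (by norm_num)).add
      (Real.GammaIntegral_convergent (s := 1 / 2) (by norm_num))
    refine Integrable.mono' (h1.const_mul 2) (by fun_prop) ?_
    filter_upwards [ae_restrict_mem measurableSet_Ioi] with y hy
    have hy : 0 < y := hy
    have hpdf : exponentialPDFReal 1 y = Real.exp (-y) := by
      simp [exponentialPDFReal, gammaPDFReal, hy.le]
    -- `log y ≤ 2 √y`, applied to `y` and to `y⁻¹`
    have hup := Real.log_le_rpow_div hy.le (ε := 1 / 2) (by norm_num)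
    have hlow := Real.log_le_rpow_div (inv_pos.2 hy).le (ε := 1 / 2) (by norm_num)
    rw [Real.log_inv, Real.inv_rpow hy.le, ← Real.rpow_neg hy.le] at hlow
    have p1 : 0 < y ^ (1 / 2 : ℝ) := Real.rpow_pos_of_pos hy _
    have p2 : 0 < y ^ (-(1 / 2) : ℝ) := Real.rpow_pos_of_pos hy _
    have hlog : |Real.log y| ≤ 2 * (y ^ (1 / 2 : ℝ) + y ^ (-(1 / 2) : ℝ)) := by
      rw [abs_le]; constructor <;> linarith
    rw [hpdf, norm_mul, Real.norm_eq_abs, Real.norm_eq_abs, Real.abs_exp]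
    calc Real.exp (-y) * |Real.log y|
        ≤ Real.exp (-y) * (2 * (y ^ (1 / 2 : ℝ) + y ^ (-(1 / 2) : ℝ))) := by gcongr
      _ = _ := by norm_num [Pi.add_apply]; ring
  change Integrable Real.log (volume.withDensity (fun y => ENNReal.ofReal (exponentialPDFReal 1 y)))
  rw [integrable_withDensity_iff hmeas.ennreal_ofReal (by simp)]
  refine hset.congr (ae_of_all _ fun y => ?_)
  simp [ENNReal.toReal_ofReal (exponentialPDFReal_nonneg one_pos y), mul_comm]

/-- The σ-algebra generated by the variables `Z i`, `i ∈ S`. -/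
@[reducible]
def infoOf {ι : Type*} (Z : ι → Ω → ℝ) (S : Set ι) : MeasurableSpace Ω :=
  ⨆ i ∈ S, MeasurableSpace.comap (Z i) inferInstance

lemma infoOf_mono {ι : Type*} (Z : ι → Ω → ℝ) {S T : Set ι} (h : S ⊆ T) :
    infoOf Z S ≤ infoOf Z T :=
  biSup_mono h

lemma measurable_infoOf {ι : Type*} (Z : ι → Ω → ℝ) {S : Set ι} {i : ι} (hi : i ∈ S) :
    Measurable[infoOf Z S] (Z i) :=
  (comap_measurable (Z i)).mono (le_biSup (fun i => MeasurableSpace.comap (Z i) inferInstance) hi)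
    le_rfl

variable [mΩ : MeasurableSpace Ω] {P : Measure Ω}

/-- A variable without atoms almost surely differs from any variable independent of it. -/
lemma ae_ne_of_indepFun [IsProbabilityMeasure P] {U Y : Ω → ℝ} {μ : Measure ℝ}
    (hY : HasLaw Y μ P) (hμ : ∀ x, μ {x} = 0) (hU : Measurable U) (h : IndepFun U Y P) :
    ∀ᵐ ω ∂P, Y ω ≠ U ω := by
  have : IsProbabilityMeasure μ := hY.isProbabilityMeasure_iff.1 ‹_›
  have hlaw := (indepFun_iff_hasLaw_prodMk_prod
    (⟨hU.aemeasurable, rfl⟩ : HasLaw U (P.map U) P) hY).1 h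
  have hs : MeasurableSet {p : ℝ × ℝ | p.2 = p.1} :=
    measurableSet_eq_fun measurable_snd measurable_fst
  have : ∀ᵐ p ∂((P.map U).prod μ), ¬ p.2 = p.1 := by
    rw [ae_iff]
    simp only [not_not]
    rw [Measure.measure_prod_null hs]
    exact ae_of_all _ fun x => hμ x
  exact (hlaw.ae_iff (p := fun p => ¬ p.2 = p.1) hs.compl.mem).2 this

lemma infoOf_le {ι : Type*} {Z : ι → Ω → ℝ} (hZ : ∀ i, Measurable (Z i)) (S : Set ι) :
    infoOf Z S ≤ mΩ :=
  iSup₂_le fun i _ => (hZ i).comap_le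

lemma indepFun_of_infoOf {ι α β : Type*} [MeasurableSpace α] [MeasurableSpace β] {Z : ι → Ω → ℝ}
    (hZ : ∀ i, Measurable (Z i)) (hind : iIndepFun Z P) {S T : Set ι} (hST : Disjoint S T)
    {U : Ω → α} {V : Ω → β} (hU : Measurable[infoOf Z S] U) (hV : Measurable[infoOf Z T] V) :
    IndepFun U V P :=
  indep_of_indep_of_le_right (indep_of_indep_of_le_left
    (indep_iSup_of_disjoint (fun i => (hZ i).comap_le) hind hST) hU.comap_le) hV.comap_le

/-! ### Queue lengths -/

lemma IsQueue.nonneg {Ω : Type*} {q₀ : Fin N → ℝ} {A R I Q : Fin N → ℕ → Ω → ℝ}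
    (hQ : IsQueue q₀ A R I Q) (n : Fin N) (t : ℕ) (ω : Ω) : 0 ≤ Q n t ω := by
  cases t with
  | zero => rw [hQ.init]; exact hQ.init_nonneg n
  | succ t => rw [hQ.step]; exact le_max_right _ _

variable {q₀ : Fin N → ℝ} {A R X I Q : Fin N → ℕ → Ω → ℝ} {channel : Fin N → Measure ℝ}
  {lam : Fin N → ℝ} {K : ℝ}

lemma IsQueue.measurable (hQ : IsQueue q₀ A R I Q) (hT : IsTraffic P channel lam A R)
    (hI : IsSchedule I) (n : Fin N) (t : ℕ) : Measurable (Q n t) := by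
  induction t with
  | zero => rw [show Q n 0 = fun _ => q₀ n from funext (hQ.init n)]; exact measurable_const
  | succ t ih =>
    rw [show Q n (t + 1) = _ from funext (hQ.step n t)]
    have := hT.measurable_arrival n t
    have := hT.measurable_rate n t
    have := hI.measurable n t
    fun_prop

lemma IsSchedule.mem_Icc (hI : IsSchedule I) (n : Fin N) (t : ℕ) (ω : Ω) :
    I n t ω ∈ Set.Icc (0 : ℝ) 1 := by
  rcases hI.zero_or_one n t ω with h | h <;> simp [h]

lemma IsTraffic.ae_rate_mem (hT : IsTraffic P channel lam A R)
    (hK : ∀ n, ∀ᵐ r ∂(channel n), r ∈ Set.Icc 0 K) :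
    ∀ᵐ ω ∂P, ∀ n t, R n t ω ∈ Set.Icc 0 K := by
  rw [ae_all_iff]; intro n
  rw [ae_all_iff]; intro t
  exact ((hT.rate_law n t).ae_iff (p := fun r => r ∈ Set.Icc 0 K) measurableSet_Icc.mem).2 (hK n)

lemma IsTraffic.ae_arrival_nonneg (hT : IsTraffic P channel lam A R) :
    ∀ᵐ ω ∂P, ∀ n t, 0 ≤ A n t ω := by
  rw [ae_all_iff]; intro n
  rw [ae_all_iff]; exact hT.arrival_nonneg n

lemma IsQueue.memLp [IsProbabilityMeasure P] (hQ : IsQueue q₀ A R I Q)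
    (hT : IsTraffic P channel lam A R) (hI : IsSchedule I)
    (hK : ∀ n, ∀ᵐ r ∂(channel n), r ∈ Set.Icc 0 K) (n : Fin N) (t : ℕ) :
    MemLp (Q n t) 2 P := by
  induction t with
  | zero => rw [show Q n 0 = fun _ => q₀ n from funext (hQ.init n)]; exact memLp_const _
  | succ t ih =>
    refine (ih.add (hT.arrival_memLp n t)).mono (hQ.measurable hT hI n _).aestronglyMeasurable ?_
    filter_upwards [hT.ae_rate_mem hK, hT.ae_arrival_nonneg] with ω hR hA
    have h1 := mul_nonneg (hR n t).1 (hI.mem_Icc n t ω).1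
    have h2 := hA n t
    have h3 := hQ.nonneg n t ω
    rw [Pi.add_apply, Real.norm_of_nonneg (hQ.nonneg n _ ω), Real.norm_of_nonneg (by linarith),
      hQ.step]
    exact max_le (by linarith) (by linarith)

lemma IsQueue.integrable [IsProbabilityMeasure P] (hQ : IsQueue q₀ A R I Q)
    (hT : IsTraffic P channel lam A R) (hI : IsSchedule I)
    (hK : ∀ n, ∀ᵐ r ∂(channel n), r ∈ Set.Icc 0 K) (n : Fin N) (t : ℕ) :
    Integrable (Q n t) P :=
  (hQ.memLp hT hI hK n t).integrable one_le_two

lemma IsTraffic.arrival_integrable [IsProbabilityMeasure P] (hT : IsTraffic P channel lam A R)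
    (n : Fin N) (t : ℕ) : Integrable (A n t) P :=
  (hT.arrival_memLp n t).integrable one_le_two

lemma lintegral_queue_eq [IsProbabilityMeasure P] (hQ : IsQueue q₀ A R I Q)
    (hT : IsTraffic P channel lam A R) (hI : IsSchedule I)
    (hK : ∀ n, ∀ᵐ r ∂(channel n), r ∈ Set.Icc 0 K) (t : ℕ) :
    ∫⁻ ω, ENNReal.ofReal (∑ n, Q n t ω) ∂P = ENNReal.ofReal (∑ n, ∫ ω, Q n t ω ∂P) := by
  rw [← integral_finsetSum _ fun n _ => hQ.integrable hT hI hK n t,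
    ofReal_integral_eq_lintegral_ofReal
      (integrable_finsetSum _ fun n _ => hQ.integrable hT hI hK n t)
      (ae_of_all _ fun ω => Finset.sum_nonneg fun n _ => hQ.nonneg n t ω)]

/-! ### The expected maximal weight -/

/-- The expectation of `max_n q n * r n` when `r` is a vector of channel rates; the maximum is
written as the sup norm of `q * r`, which agrees with it since all entries are nonnegative. -/
noncomputable def expectedMaxWeight (channel : Fin N → Measure ℝ) (q : Fin N → ℝ) : ℝ :=
  ∫ r, ‖q * r‖ ∂(Measure.pi channel)

lemma IsTraffic.hasLaw_rates [IsProbabilityMeasure P] (hT : IsTraffic P channel lam A R) (t : ℕ) :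
    HasLaw (fun ω n => R n t ω) (Measure.pi channel) P := by
  have hind : iIndepFun (fun n => R n t) P :=
    hT.indep.precomp (g := fun n : Fin N => Sum.inr (n, t)) (by intro a b h; simpa using h)
  exact hind.hasLaw_pi fun n => hT.rate_law n t

/-- No rule can serve more weight than the maximum available in the slot. -/
lemma IsSchedule.sum_mul_le (hI : IsSchedule I) (w : Fin N → ℝ) (t : ℕ) (ω : Ω) :
    ∑ n, w n * I n t ω ≤ ‖w‖ :=
  calc ∑ n, w n * I n t ω ≤ ∑ n, ‖w‖ * I n t ω := by
        refine Finset.sum_le_sum fun n _ => ?_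
        exact mul_le_mul_of_nonneg_right ((Real.le_norm_self _).trans (norm_le_pi_norm w n))
          (hI.mem_Icc n t ω).1
    _ = ‖w‖ * ∑ n, I n t ω := by rw [Finset.mul_sum]
    _ ≤ ‖w‖ := mul_le_of_le_one_right (norm_nonneg _) (hI.sum_le_one t ω)

lemma integrable_norm_mul_rates [IsProbabilityMeasure P] (hT : IsTraffic P channel lam A R)
    (hK : ∀ n, ∀ᵐ r ∂(channel n), r ∈ Set.Icc 0 K) {t : ℕ} {V : Fin N → Ω → ℝ}
    (hV : ∀ n, Integrable (V n) P) :
    Integrable (fun ω => ‖(fun n => V n ω) * (fun n => R n t ω)‖) P := by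
  have hm : AEStronglyMeasurable (fun ω => (fun n => V n ω) * (fun n => R n t ω)) P := by
    refine AEMeasurable.aestronglyMeasurable (aemeasurable_pi_lambda _ fun n => ?_)
    exact (hV n).aemeasurable.mul (hT.measurable_rate n t).aemeasurable
  refine Integrable.mono' (integrable_finsetSum Finset.univ fun n _ => (hV n).norm.mul_const K)
    hm.norm ?_
  filter_upwards [hT.ae_rate_mem hK] with ω hR
  have hnn : ∀ n, 0 ≤ ‖V n ω‖ * K := fun n =>
    mul_nonneg (norm_nonneg _) ((hR n t).1.trans (hR n t).2)
  rw [norm_norm, pi_norm_le_iff_of_nonneg (Finset.sum_nonneg fun n _ => hnn n)]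
  intro n
  refine le_trans ?_ (Finset.single_le_sum (fun n _ => hnn n) (Finset.mem_univ n))
  rw [Pi.mul_apply, norm_mul, Real.norm_of_nonneg (hR n t).1]
  exact mul_le_mul_of_nonneg_left (hR n t).2 (norm_nonneg _)

/-- The backlog weighted by `q` grows in each slot by at least the weighted arrivals minus the
maximal weight, whatever the scheduling rule. -/
lemma le_integral_queue [IsProbabilityMeasure P] (hQ : IsQueue q₀ A R I Q)
    (hT : IsTraffic P channel lam A R) (hI : IsSchedule I)
    (hK : ∀ n, ∀ᵐ r ∂(channel n), r ∈ Set.Icc 0 K) {q : Fin N → ℝ} (hq : ∀ n, 0 ≤ q n) (t : ℕ) :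
    t * (∑ n, q n * lam n - expectedMaxWeight channel q) ≤ ∑ n, q n * ∫ ω, Q n t ω ∂P := by
  induction t with
  | zero =>
    simp only [Nat.cast_zero, zero_mul]
    exact Finset.sum_nonneg fun n _ =>
      mul_nonneg (hq n) (integral_nonneg fun ω => hQ.nonneg n 0 ω)
  | succ t ih =>
    have iQ := fun t => integrable_finsetSum Finset.univ fun n _ =>
      (hQ.integrable hT hI hK n t).const_mul (q n)
    have iA := integrable_finsetSum Finset.univ fun n _ =>
      (hT.arrival_integrable n t).const_mul (q n)
    have eQ : ∀ t, ∫ ω, ∑ n, q n * Q n t ω ∂P = ∑ n, q n * ∫ ω, Q n t ω ∂P := fun t => by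
      rw [integral_finsetSum _ fun n _ => (hQ.integrable hT hI hK n t).const_mul (q n)]
      simp only [integral_const_mul]
    have eA : ∫ ω, ∑ n, q n * A n t ω ∂P = ∑ n, q n * lam n := by
      rw [integral_finsetSum _ fun n _ => (hT.arrival_integrable n t).const_mul (q n)]
      simp only [integral_const_mul, hT.arrival_mean]
    have iM := integrable_norm_mul_rates hT hK (t := t) (V := fun n _ => q n)
      fun n => integrable_const _
    have hmax : ∫ ω, ‖q * (fun n => R n t ω)‖ ∂P = expectedMaxWeight channel q :=
      (hT.hasLaw_rates t).integral_comp (f := fun r => ‖q * r‖) (by fun_prop)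
    have key : ∫ ω, ((∑ n, q n * Q n t ω) + (∑ n, q n * A n t ω) - ‖q * (fun n => R n t ω)‖) ∂P
        ≤ ∫ ω, ∑ n, q n * Q n (t + 1) ω ∂P := by
      refine integral_mono (((iQ t).add iA).sub iM) (iQ (t + 1)) fun ω => ?_
      have h1 := hI.sum_mul_le (q * fun n => R n t ω) t ω
      have h2 : ∑ n, (q n * Q n t ω + q n * A n t ω - (q * fun n => R n t ω) n * I n t ω)
          ≤ ∑ n, q n * Q n (t + 1) ω := by
        refine Finset.sum_le_sum fun n _ => ?_
        rw [hQ.step, Pi.mul_apply]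
        refine le_trans (le_of_eq ?_) (mul_le_mul_of_nonneg_left (le_max_left _ _) (hq n))
        ring
      rw [Finset.sum_sub_distrib, Finset.sum_add_distrib] at h2
      linarith
    have e1 := integral_sub ((iQ t).add iA) iM
    have e2 := integral_add (iQ t) iA
    simp only [Pi.add_apply] at e1 e2
    rw [eQ (t + 1)] at key
    rw [eQ t, eA] at e2
    push_cast
    change _ = _ - ∫ ω, ‖q * (fun n => R n t ω)‖ ∂P at e1
    linarith

lemma not_stable_of_linear_growth {E : ℕ → ℝ} {c : ℝ} (hc : 0 < c) (hE : ∀ t : ℕ, t * c ≤ E t) :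
    ¬ limsup (fun T : ℕ => (∑ t ∈ Finset.range T, ENNReal.ofReal (E t)) / (T : ℝ≥0∞)) atTop
      < ∞ := by
  intro h
  obtain ⟨D, hD, hD'⟩ := exists_between h
  have hev := eventually_lt_of_limsup_lt hD
  obtain ⟨T, hT, hT1, hTD⟩ := (hev.and ((eventually_ge_atTop 1).and
    (tendsto_natCast_atTop_atTop.eventually_gt_atTop (2 * D.toReal / c + 1)))).exists
  have hT0 : (0 : ℝ) < T := by exact_mod_cast hT1
  have hE0 : ∀ t, 0 ≤ E t := fun t => le_trans (by positivity) (hE t)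
  rw [ENNReal.div_lt_iff (by simp; omega) (by simp), ← ENNReal.ofReal_sum_of_nonneg
    (fun t _ => hE0 t), ← ENNReal.ofReal_toReal hD'.ne, ← ENNReal.ofReal_natCast,
    ← ENNReal.ofReal_mul ENNReal.toReal_nonneg, ENNReal.ofReal_lt_ofReal_iff_of_nonneg
    (Finset.sum_nonneg fun t _ => hE0 t)] at hT
  have hsum : (∑ t ∈ Finset.range T, (t : ℝ)) * 2 = T * (T - 1) := by
    have := Finset.sum_range_id_mul_two T
    have h' : ((∑ t ∈ Finset.range T, t : ℕ) : ℝ) * 2 = (T : ℝ) * ((T - 1 : ℕ) : ℝ) := by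
      exact_mod_cast this
    rw [Nat.cast_sub hT1] at h'
    push_cast at h'
    exact h'
  have hle : (∑ t ∈ Finset.range T, (t : ℝ)) * c ≤ ∑ t ∈ Finset.range T, E t := by
    rw [Finset.sum_mul]; exact Finset.sum_le_sum fun t _ => hE t
  have h1 : D.toReal * 2 < c * (T - 1) := by
    have : 2 * D.toReal / c < T - 1 := by linarith
    rw [div_lt_iff₀ hc] at this
    linarith
  nlinarith

/-- Outer bound on the capacity region: the rate vectors that any rule, causal or not, can
stabilize satisfy `∑ q n * mu n ≤ E[max_n q n * r n]` for all nonnegative `q`. -/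
lemma sum_mul_le_expectedMaxWeight {mu : Fin N → ℝ} (hmu : mu ∈ capacityRegion channel)
    (hK : ∀ n, ∀ᵐ r ∂(channel n), r ∈ Set.Icc 0 K) {q : Fin N → ℝ} (hq : ∀ n, 0 ≤ q n) :
    ∑ n, q n * mu n ≤ expectedMaxWeight channel q := by
  obtain ⟨Ω, _, P, _, q₀, A, R, I, Q, hT, hI, hQ, hS⟩ := hmu
  by_contra! hlt
  set d := ∑ n, q n * mu n - expectedMaxWeight channel q with hd
  have hd0 : 0 < d := sub_pos.2 hlt
  have hEnn : ∀ n t, 0 ≤ ∫ ω, Q n t ω ∂P := fun n t => integral_nonneg fun ω => hQ.nonneg n t ω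
  have hgrow : ∀ t : ℕ, t * (d / (‖q‖ + 1)) ≤ ∑ n, ∫ ω, Q n t ω ∂P := by
    intro t
    rw [mul_div_assoc', div_le_iff₀ (by positivity), Finset.sum_mul]
    refine (le_integral_queue hQ hT hI hK hq t).trans (Finset.sum_le_sum fun n _ => ?_)
    rw [mul_comm]
    refine mul_le_mul_of_nonneg_left ?_ (hEnn n t)
    have := (Real.le_norm_self _).trans (norm_le_pi_norm q n)
    linarith
  refine not_stable_of_linear_growth (by positivity) hgrow ?_
  unfold Stable at hS
  simpa only [lintegral_queue_eq hQ hT hI hK] using hS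

end Wireless

namespace Wireless

variable {N : ℕ} {Ω : Type*}

/-! ### The variables driving DMW-AB -/

/-- The normalized back-off time of user `n` in slot `t`. -/
noncomputable def clock (b : ℝ) (R X Q : Fin N → ℕ → Ω → ℝ) (n : Fin N) (t : ℕ) (ω : Ω) : ℝ :=
  b ^ weight Q R n t ω * X n t ω

/-- Index type of the driving variables: arrivals, channel rates, normalized back-off times. -/
abbrev DrivingIndex (N : ℕ) : Type := (Fin N × ℕ) ⊕ ((Fin N × ℕ) ⊕ (Fin N × ℕ))

/-- The independent variables from which the network under DMW-AB is built. -/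
noncomputable def driving (b : ℝ) (A R X Q : Fin N → ℕ → Ω → ℝ) : DrivingIndex N → Ω → ℝ :=
  Sum.elim (fun i => A i.1 i.2) (Sum.elim (fun i => R i.1 i.2) (fun i => clock b R X Q i.1 i.2))

/-- The indices of the driving variables of the slots before `t`. -/
def pastIndices (N t : ℕ) : Set (DrivingIndex N) :=
  {i | Sum.elim Prod.snd (Sum.elim Prod.snd Prod.snd) i < t}

variable {b : ℝ} {q₀ : Fin N → ℝ} {A R X I Q : Fin N → ℕ → Ω → ℝ}

lemma backoff_eq (hb : 1 < b) (n : Fin N) (t : ℕ) (ω : Ω) :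
    X n t ω = clock b R X Q n t ω / b ^ weight Q R n t ω := by
  have : 0 < b ^ weight Q R n t ω := Real.rpow_pos_of_pos (by linarith) _
  rw [clock, mul_div_cancel_left₀ _ this.ne']

lemma measurable_backoff_of {m : MeasurableSpace Ω} (hb : 1 < b) {n : Fin N} {t : ℕ}
    (hQ : Measurable (Q n t)) (hR : Measurable (R n t)) (hY : Measurable (clock b R X Q n t)) :
    Measurable (X n t) := by
  rw [show X n t = _ from funext (backoff_eq (X := X) (R := R) (Q := Q) hb n t)]
  unfold weight
  fun_prop

lemma measurableSet_wins {m : MeasurableSpace Ω} {t : ℕ} (hX : ∀ k, Measurable (X k t))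
    (n : Fin N) : MeasurableSet {ω | ∀ m, m ≠ n → X n t ω < X m t ω} := by
  rw [show {ω | ∀ m, m ≠ n → X n t ω < X m t ω} = ⋂ k, ⋂ (_ : k ≠ n), {ω | X n t ω < X k t ω} by
    ext; simp]
  exact .iInter fun k => .iInter fun _ => measurableSet_lt (hX n) (hX k)

lemma measurable_winner {m : MeasurableSpace Ω} {t : ℕ} (hX : ∀ k, Measurable (X k t))
    (n : Fin N) :
    Measurable ({ω | ∀ m, m ≠ n → X n t ω < X m t ω}.indicator (1 : Ω → ℝ)) :=
  measurable_one.indicator (measurableSet_wins hX n)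

lemma measurable_joint {m : MeasurableSpace Ω} {Z : Fin N → ℕ → Ω → ℝ} {t : ℕ}
    (hZ : ∀ n, Measurable (Z n t)) : Measurable (fun ω n => Z n t ω) :=
  measurable_pi_iff.2 hZ

section schedule

variable [MeasurableSpace Ω] {P : Measure Ω} {f : ℝ → ℝ}

lemma IsDMWAB.eq_ite (hD : IsDMWAB f P A R X I Q) (n : Fin N) (t : ℕ) :
    I n t = Set.indicator {ω | ∀ m, m ≠ n → X n t ω < X m t ω} 1 := by
  ext ω
  by_cases h : ∀ m, m ≠ n → X n t ω < X m t ω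
  · rw [hD.scheduled n t ω h, Set.indicator_of_mem (by exact h), Pi.one_apply]
  · rw [hD.silent n t ω h, Set.indicator_of_notMem (by exact h)]

lemma IsDMWAB.isSchedule (hD : IsDMWAB f P A R X I Q) : IsSchedule I where
  measurable n t := by
    rw [hD.eq_ite]
    exact measurable_winner (fun k => hD.measurable_backoff k t) n
  zero_or_one n t ω := by
    by_cases h : ∀ m, m ≠ n → X n t ω < X m t ω
    · exact .inr (hD.scheduled n t ω h)
    · exact .inl (hD.silent n t ω h)
  sum_le_one t ω := by
    by_cases h : ∃ n, ∀ m, m ≠ n → X n t ω < X m t ω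
    · obtain ⟨n, hn⟩ := h
      rw [Finset.sum_eq_single n (fun m _ hm => hD.silent m t ω fun hm' =>
        lt_asymm (hn m hm) (hm' n hm.symm)) (by simp), hD.scheduled n t ω hn]
    · rw [Finset.sum_eq_zero fun n _ => hD.silent n t ω fun hn => h ⟨n, hn⟩]
      exact zero_le_one

end schedule

lemma IsQueue.measurable_past [MeasurableSpace Ω] {P : Measure Ω} (hb : 1 < b)
    (hD : IsDMWAB (fun x : ℝ => b ^ x) P A R X I Q) (hQ : IsQueue q₀ A R I Q) (n : Fin N) (t : ℕ) :
    Measurable[infoOf (driving b A R X Q) (pastIndices N t)] (Q n t) := by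
  induction t generalizing n with
  | zero => rw [show Q n 0 = fun _ => q₀ n from funext (hQ.init n)]; exact measurable_const
  | succ t ih =>
    set Z := driving b A R X Q with hZ
    set S := pastIndices N (t + 1) with hS
    have hQt : ∀ k, Measurable[infoOf Z S] (Q k t) := fun k =>
      (ih k).mono (infoOf_mono Z fun i hi => Nat.lt_succ_of_lt hi) le_rfl
    have hA : ∀ k, Measurable[infoOf Z S] (A k t) := fun k =>
      measurable_infoOf Z (i := Sum.inl (k, t)) (Nat.lt_succ_self t)
    have hR : ∀ k, Measurable[infoOf Z S] (R k t) := fun k =>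
      measurable_infoOf Z (i := Sum.inr (Sum.inl (k, t))) (Nat.lt_succ_self t)
    have hY : ∀ k, Measurable[infoOf Z S] (clock b R X Q k t) := fun k =>
      measurable_infoOf Z (i := Sum.inr (Sum.inr (k, t))) (Nat.lt_succ_self t)
    have hX : ∀ k, Measurable[infoOf Z S] (X k t) := fun k =>
      measurable_backoff_of hb (hQt k) (hR k) (hY k)
    have hI : Measurable[infoOf Z S] (I n t) := by
      rw [hD.eq_ite]
      exact measurable_winner hX n
    rw [show Q n (t + 1) = _ from funext (hQ.step n t)]
    exact (((hQt n).add (hA n)).sub ((hR n).mul hI)).max measurable_const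

variable [MeasurableSpace Ω] {P : Measure Ω} {channel : Fin N → Measure ℝ} {lam : Fin N → ℝ}
  {K : ℝ}

section independence

variable (hb : 1 < b) (hT : IsTraffic P channel lam A R)
  (hD : IsDMWAB (fun x : ℝ => b ^ x) P A R X I Q) (hQ : IsQueue q₀ A R I Q)

include hT hD hQ

lemma measurable_driving (i : DrivingIndex N) : Measurable (driving b A R X Q i) := by
  rcases i with i | i | i
  · exact hT.measurable_arrival _ _
  · exact hT.measurable_rate _ _
  · have h1 := hQ.measurable hT hD.isSchedule i.1 i.2
    have h2 := hT.measurable_rate i.1 i.2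
    have h3 := hD.measurable_backoff i.1 i.2
    change Measurable (clock b R X Q i.1 i.2)
    unfold clock weight
    fun_prop

include hb

lemma indepFun_queue_arrival (n : Fin N) (t : ℕ) : IndepFun (Q n t) (A n t) P := by
  refine indepFun_of_infoOf (T := {Sum.inl (n, t)}) (measurable_driving hT hD hQ) hD.indep ?_
    (hQ.measurable_past hb hD n t) (measurable_infoOf _ (i := Sum.inl (n, t)) rfl)
  simp [pastIndices]

lemma indepFun_queues_rates (t : ℕ) :
    IndepFun (fun ω n => Q n t ω) (fun ω n => R n t ω) P := by
  refine indepFun_of_infoOf (T := Set.range fun n => Sum.inr (Sum.inl (n, t)))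
    (measurable_driving hT hD hQ) hD.indep ?_
    (measurable_joint fun n => hQ.measurable_past hb hD n t)
    (measurable_joint fun n => measurable_infoOf _ (i := Sum.inr (Sum.inl (n, t))) ⟨n, rfl⟩)
  rw [Set.disjoint_right]
  rintro _ ⟨n, rfl⟩
  simp [pastIndices]

/-- Almost surely no two users draw the same back-off time. -/
lemma ae_backoff_ne [IsProbabilityMeasure P] :
    ∀ᵐ ω ∂P, ∀ t n m, n ≠ m → X n t ω ≠ X m t ω := by
  simp only [ae_all_iff]
  intro t n m hnm
  set Z := driving b A R X Q with hZ
  set S : Set (DrivingIndex N) := {Sum.inr (Sum.inr (n, t))}ᶜ with hS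
  have hQt : ∀ k, Measurable[infoOf Z S] (Q k t) := fun k =>
    (hQ.measurable_past hb hD k t).mono
      (infoOf_mono Z fun i hi h => by subst h; simp [pastIndices] at hi) le_rfl
  have hR : ∀ k, Measurable[infoOf Z S] (R k t) := fun k =>
    measurable_infoOf Z (i := Sum.inr (Sum.inl (k, t))) (by simp [hS])
  have hY : Measurable[infoOf Z S] (clock b R X Q m t) :=
    measurable_infoOf Z (i := Sum.inr (Sum.inr (m, t))) (by simp [hS, hnm.symm])
  have hX : Measurable[infoOf Z S] (X m t) := measurable_backoff_of hb (hQt m) (hR m) hY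
  have hpow : ∀ {m : MeasurableSpace Ω}, Measurable (Q n t) → Measurable (R n t) →
      Measurable (fun ω => b ^ weight Q R n t ω) := fun h1 h2 => by
    unfold weight; fun_prop
  have hU : Measurable[infoOf Z S] (fun ω => b ^ weight Q R n t ω * X m t ω) :=
    (hpow (hQt n) (hR n)).mul hX
  have hind := indepFun_of_infoOf (measurable_driving hT hD hQ) hD.indep
    (disjoint_compl_left (a := {Sum.inr (Sum.inr (n, t))})) hU
    (measurable_infoOf _ (i := Sum.inr (Sum.inr (n, t))) rfl)
  filter_upwards [ae_ne_of_indepFun (hD.backoff_law n t) expMeasure_singleton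
    (hU.mono (infoOf_le (measurable_driving hT hD hQ) S) le_rfl) hind] with ω hne heq
  exact hne (by simp only [heq])

end independence

/-! ### DMW-AB serves almost the maximal weight -/

/-- Total logarithmic fluctuation of the normalized back-off times of slot `t`. -/
noncomputable def logFluctuation (b : ℝ) (R X Q : Fin N → ℕ → Ω → ℝ) (t : ℕ) (ω : Ω) : ℝ :=
  ∑ n, |Real.logb b (clock b R X Q n t ω)|

lemma integrable_abs_logb (b : ℝ) : Integrable (fun y => |Real.logb b y|) (expMeasure 1) := by
  unfold Real.logb
  exact (integrable_log_expMeasure.div_const _).abs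

lemma integrable_abs_logb_clock (hD : IsDMWAB (fun x : ℝ => b ^ x) P A R X I Q)
    (n : Fin N) (t : ℕ) : Integrable (fun ω => |Real.logb b (clock b R X Q n t ω)|) P :=
  ((hD.backoff_law n t).map_eq ▸ integrable_abs_logb b).comp_aemeasurable
    (hD.backoff_law n t).aemeasurable

lemma integral_logFluctuation (hD : IsDMWAB (fun x : ℝ => b ^ x) P A R X I Q) (t : ℕ) :
    ∫ ω, logFluctuation b R X Q t ω ∂P = N * ∫ y, |Real.logb b y| ∂(expMeasure 1) := by
  unfold logFluctuation
  rw [integral_finsetSum _ fun n _ => integrable_abs_logb_clock hD n t]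
  have : ∀ n, ∫ ω, |Real.logb b (clock b R X Q n t ω)| ∂P
      = ∫ y, |Real.logb b y| ∂(expMeasure 1) := fun n =>
    (hD.backoff_law n t).integral_comp (f := fun y => |Real.logb b y|)
      (integrable_abs_logb b).aestronglyMeasurable
  simp [this]

/-- Since `logb b (X n t) = logb b (clock n t) - weight n t`, the user with the smallest back-off
time has the maximal weight up to the fluctuation of the logarithms of the clocks. -/
lemma norm_weight_le [IsProbabilityMeasure P] (hb : 1 < b) (hT : IsTraffic P channel lam A R)
    (hD : IsDMWAB (fun x : ℝ => b ^ x) P A R X I Q) (hQ : IsQueue q₀ A R I Q)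
    (hK : ∀ n, ∀ᵐ r ∂(channel n), r ∈ Set.Icc 0 K) :
    ∀ᵐ ω ∂P, ∀ t, ‖(fun n => Q n t ω) * (fun n => R n t ω)‖ ≤
      ∑ n, weight Q R n t ω * I n t ω + 2 * logFluctuation b R X Q t ω := by
  have hpos : ∀ᵐ ω ∂P, ∀ n t, 0 < clock b R X Q n t ω := by
    simp only [ae_all_iff]
    exact fun n t => ((hD.backoff_law n t).ae_iff (p := fun y => 0 < y)
      measurableSet_Ioi.mem).2 ae_pos_expMeasure
  filter_upwards [hpos, ae_backoff_ne hb hT hD hQ, hT.ae_rate_mem hK] with ω hY hne hR t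
  have hw : ∀ n, 0 ≤ weight Q R n t ω := fun n => mul_nonneg (hQ.nonneg n t ω) (hR n t).1
  have hL : ∀ n, |Real.logb b (clock b R X Q n t ω)| ≤ logFluctuation b R X Q t ω := fun n =>
    Finset.single_le_sum (f := fun n => |Real.logb b (clock b R X Q n t ω)|)
      (fun n _ => abs_nonneg _) (Finset.mem_univ n)
  have hL0 : 0 ≤ logFluctuation b R X Q t ω := Finset.sum_nonneg fun n _ => abs_nonneg _
  have hS : 0 ≤ ∑ n, weight Q R n t ω * I n t ω := Finset.sum_nonneg fun n _ =>
    mul_nonneg (hw n) (hD.isSchedule.mem_Icc n t ω).1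
  rw [pi_norm_le_iff_of_nonneg (by positivity)]
  intro m
  rw [Pi.mul_apply]
  change ‖weight Q R m t ω‖ ≤ _
  rw [Real.norm_of_nonneg (hw m)]
  obtain ⟨n, -, hmin⟩ := Finset.exists_min_image Finset.univ (fun k => X k t ω)
    ⟨m, Finset.mem_univ m⟩
  have hIn : I n t ω = 1 := hD.scheduled n t ω fun k hk =>
    lt_of_le_of_ne (hmin k (Finset.mem_univ k)) (hne t n k hk.symm)
  have hwn : weight Q R n t ω ≤ ∑ n, weight Q R n t ω * I n t ω := by
    refine le_trans (by rw [hIn, mul_one]) (Finset.single_le_sum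
      (f := fun n => weight Q R n t ω * I n t ω)
      (fun n _ => mul_nonneg (hw n) (hD.isSchedule.mem_Icc n t ω).1) (Finset.mem_univ n))
  have hlog : ∀ k, Real.logb b (X k t ω)
      = Real.logb b (clock b R X Q k t ω) - weight Q R k t ω := fun k => by
    have hbk : 0 < b ^ weight Q R k t ω := Real.rpow_pos_of_pos (by linarith) _
    rw [backoff_eq (X := X) (R := R) (Q := Q) hb k t ω, Real.logb_div (hY k t).ne' hbk.ne',
      Real.logb_rpow (by linarith) hb.ne']
  have hXn : 0 < X n t ω := by
    rw [backoff_eq (X := X) (R := R) (Q := Q) hb n t ω]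
    exact div_pos (hY n t) (Real.rpow_pos_of_pos (by linarith) _)
  have hle := Real.logb_le_logb_of_le hb hXn (hmin m (Finset.mem_univ m))
  rw [hlog, hlog] at hle
  have h1 := (abs_le.1 (hL n)).1
  have h2 := (abs_le.1 (hL m)).2
  linarith

/-! ### Lyapunov drift -/

/-- Pathwise drift of the quadratic Lyapunov function. -/
lemma sum_sq_step (hT : IsTraffic P channel lam A R) (hI : IsSchedule I)
    (hQ : IsQueue q₀ A R I Q) (hK : ∀ n, ∀ᵐ r ∂(channel n), r ∈ Set.Icc 0 K) :
    ∀ᵐ ω ∂P, ∀ t, ∑ n, Q n (t + 1) ω ^ 2 + 2 * ∑ n, weight Q R n t ω * I n t ω ≤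
      ∑ n, Q n t ω ^ 2 + 2 * ∑ n, Q n t ω * A n t ω + ∑ n, A n t ω ^ 2 + N * K ^ 2 := by
  filter_upwards [hT.ae_rate_mem hK, hT.ae_arrival_nonneg] with ω hR hA t
  have hterm : ∀ n, Q n (t + 1) ω ^ 2 + 2 * (weight Q R n t ω * I n t ω) ≤
      Q n t ω ^ 2 + 2 * (Q n t ω * A n t ω) + A n t ω ^ 2 + K ^ 2 := by
    intro n
    have hS0 : 0 ≤ R n t ω * I n t ω := mul_nonneg (hR n t).1 (hI.mem_Icc n t ω).1
    have hSK : R n t ω * I n t ω ≤ K :=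
      (mul_le_of_le_one_right (hR n t).1 (hI.mem_Icc n t ω).2).trans (hR n t).2
    have hsq : Q n (t + 1) ω ^ 2 ≤ (Q n t ω + A n t ω - R n t ω * I n t ω) ^ 2 := by
      rw [hQ.step, ← sq_abs (Q n t ω + A n t ω - R n t ω * I n t ω)]
      exact pow_le_pow_left₀ (le_max_right _ _) (max_le (le_abs_self _) (abs_nonneg _)) 2
    have h1 := mul_nonneg (hA n t) hS0
    have h2 := pow_le_pow_left₀ hS0 hSK 2
    unfold weight
    nlinarith
  have := Finset.sum_le_sum fun n (_ : n ∈ Finset.univ) => hterm n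
  simpa only [Finset.sum_add_distrib, ← Finset.mul_sum, Finset.sum_const, Finset.card_univ,
    Fintype.card_fin, nsmul_eq_mul] using this

section drift

variable [IsProbabilityMeasure P] [∀ n, IsProbabilityMeasure (channel n)] {mu : Fin N → ℝ}

/-- The queues are independent of the current channel rates, so the outer bound on the capacity
region bounds the expected maximal weight from below. -/
lemma sum_mul_integral_le (hb : 1 < b) (hT : IsTraffic P channel lam A R)
    (hD : IsDMWAB (fun x : ℝ => b ^ x) P A R X I Q) (hQ : IsQueue q₀ A R I Q)
    (hK : ∀ n, ∀ᵐ r ∂(channel n), r ∈ Set.Icc 0 K) (hmu : mu ∈ capacityRegion channel) (t : ℕ) :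
    ∑ n, mu n * ∫ ω, Q n t ω ∂P ≤ ∫ ω, ‖(fun n => Q n t ω) * (fun n => R n t ω)‖ ∂P := by
  have hI := hD.isSchedule
  have hQm : Measurable (fun ω n => Q n t ω) :=
    measurable_joint fun n => hQ.measurable hT hI n t
  have hlawQ : HasLaw (fun ω n => Q n t ω) (P.map fun ω n => Q n t ω) P := ⟨hQm.aemeasurable, rfl⟩
  have : IsProbabilityMeasure (P.map fun ω n => Q n t ω) :=
    Measure.isProbabilityMeasure_map hQm.aemeasurable
  have hlaw := (indepFun_iff_hasLaw_prodMk_prod hlawQ (hT.hasLaw_rates t)).1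
    (indepFun_queues_rates hb hT hD hQ t)
  have hQi := fun n => hQ.integrable hT hI hK n t
  have hint : Integrable (fun p : (Fin N → ℝ) × (Fin N → ℝ) => ‖p.1 * p.2‖)
      ((P.map fun ω n => Q n t ω).prod (Measure.pi channel)) := by
    rw [← hlaw.map_eq, integrable_map_measure (by fun_prop) hlaw.aemeasurable]
    exact integrable_norm_mul_rates hT hK hQi
  have hval : ∫ ω, ‖(fun n => Q n t ω) * (fun n => R n t ω)‖ ∂P
      = ∫ ω, expectedMaxWeight channel (fun n => Q n t ω) ∂P := by
    have h1 := hlaw.integral_comp (f := fun p : (Fin N → ℝ) × (Fin N → ℝ) => ‖p.1 * p.2‖)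
      (by fun_prop)
    rw [integral_prod _ hint] at h1
    refine h1.trans (integral_map hQm.aemeasurable hint.integral_prod_left.aestronglyMeasurable)
  have hE : Integrable (fun ω => expectedMaxWeight channel (fun n => Q n t ω)) P :=
    hint.integral_prod_left.comp_aemeasurable hQm.aemeasurable
  have hsum : ∑ n, mu n * ∫ ω, Q n t ω ∂P = ∫ ω, ∑ n, Q n t ω * mu n ∂P := by
    rw [integral_finsetSum _ fun n _ => (hQi n).mul_const _]
    simp only [integral_mul_const, mul_comm]
  rw [hval, hsum]
  exact integral_mono (integrable_finsetSum _ fun n _ => (hQi n).mul_const _) hE fun ω =>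
    sum_mul_le_expectedMaxWeight hmu hK fun n => hQ.nonneg n t ω

lemma drift_bound (hb : 1 < b) (hT : IsTraffic P channel lam A R)
    (hD : IsDMWAB (fun x : ℝ => b ^ x) P A R X I Q) (hQ : IsQueue q₀ A R I Q)
    (hK : ∀ n, ∀ᵐ r ∂(channel n), r ∈ Set.Icc 0 K) (hmu : mu ∈ capacityRegion channel) (t : ℕ) :
    ∑ n, ∫ ω, Q n (t + 1) ω ^ 2 ∂P + 2 * ∑ n, (mu n - lam n) * ∫ ω, Q n t ω ∂P ≤
      ∑ n, ∫ ω, Q n t ω ^ 2 ∂P + (∑ n, ∫ ω, A n 0 ω ^ 2 ∂P + N * K ^ 2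
        + 4 * (N * ∫ y, |Real.logb b y| ∂(expMeasure 1))) := by
  have hI := hD.isSchedule
  have iQ := fun n => hQ.integrable hT hI hK n t
  have iQ2 := fun t n => (hQ.memLp hT hI hK n t).integrable_sq
  have iA2 := fun n => (hT.arrival_memLp n t).integrable_sq
  have iQA : ∀ n, Integrable (fun ω => Q n t ω * A n t ω) P := fun n =>
    (hQ.memLp hT hI hK n t).integrable_mul (hT.arrival_memLp n t)
  have iM := integrable_norm_mul_rates hT hK (t := t) iQ
  have iL : Integrable (logFluctuation b R X Q t) P :=
    integrable_finsetSum _ fun n _ => integrable_abs_logb_clock hD n t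
  have sQ2 := fun t => integrable_finsetSum Finset.univ fun n _ => iQ2 t n
  have sQA := integrable_finsetSum Finset.univ fun n _ => iQA n
  have sA2 := integrable_finsetSum Finset.univ fun n _ => iA2 n
  have hpath : ∀ᵐ ω ∂P, ∑ n, Q n (t + 1) ω ^ 2 ≤ ∑ n, Q n t ω ^ 2 + 2 * ∑ n, Q n t ω * A n t ω
      + ∑ n, A n t ω ^ 2 + N * K ^ 2 + 4 * logFluctuation b R X Q t ω
      - 2 * ‖(fun n => Q n t ω) * (fun n => R n t ω)‖ := by
    filter_upwards [sum_sq_step hT hI hQ hK, norm_weight_le hb hT hD hQ hK] with ω h1 h2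
    linarith [h1 t, h2 t]
  have j1 := (sQ2 t).add (sQA.const_mul 2)
  have j2 := j1.add sA2
  have j3 := j2.add (integrable_const (N * K ^ 2 : ℝ))
  have j4 := j3.add (iL.const_mul 4)
  have key := integral_mono_ae (sQ2 (t + 1)) (j4.sub (iM.const_mul 2)) hpath
  rw [integral_sub' j4 (iM.const_mul 2), integral_add' j3 (iL.const_mul 4),
    integral_add' j2 (integrable_const _), integral_add' j1 sA2,
    integral_add' (sQ2 t) (sQA.const_mul 2)] at key
  have eA2 : ∀ n, ∫ ω, A n t ω ^ 2 ∂P = ∫ ω, A n 0 ω ^ 2 ∂P := fun n =>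
    ((hT.arrival_stationary n t).comp (measurable_id.pow_const 2)).integral_eq
  have eQA : ∀ n, ∫ ω, Q n t ω * A n t ω ∂P = lam n * ∫ ω, Q n t ω ∂P := fun n => by
    rw [(indepFun_queue_arrival hb hT hD hQ n t).integral_fun_mul_eq_mul_integral
      (iQ n).aestronglyMeasurable (hT.arrival_memLp n t).aestronglyMeasurable, mul_comm,
      hT.arrival_mean]
  simp only [integral_const_mul, integral_finsetSum _ fun n _ => iQ2 _ n,
    integral_finsetSum _ fun n _ => iQA n, integral_finsetSum _ fun n _ => iA2 n, eA2, eQA,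
    integral_logFluctuation hD, integral_const, probReal_univ, one_smul] at key
  have hmax := sum_mul_integral_le hb hT hD hQ hK hmu t
  simp only [sub_mul, Finset.sum_sub_distrib]
  linarith

end drift

/-- The Foster–Lyapunov criterion in the mean: telescoping the drift bounds the time averages. -/
lemma limsup_lt_top_of_drift {V E : ℕ → ℝ} {ε B : ℝ} (hε : 0 < ε) (hV : ∀ t, 0 ≤ V t)
    (hE : ∀ t, 0 ≤ E t) (hdrift : ∀ t, V (t + 1) + ε * E t ≤ V t + B) :
    limsup (fun T : ℕ => (∑ t ∈ Finset.range T, ENNReal.ofReal (E t)) / (T : ℝ≥0∞)) atTop < ∞ := by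
  have htel : ∀ T : ℕ, V T + ε * ∑ t ∈ Finset.range T, E t ≤ V 0 + T * B := by
    intro T
    induction T with
    | zero => simp
    | succ T ih =>
      rw [Finset.sum_range_succ]
      push_cast
      linarith [hdrift T]
  refine lt_of_le_of_lt
    (limsup_le_of_le (a := ENNReal.ofReal ((V 0 + |B|) / ε)) (by isBoundedDefault) ?_) ENNReal.ofReal_lt_top
  filter_upwards [eventually_ge_atTop 1] with T hT
  have hT1 : (1 : ℝ) ≤ T := by exact_mod_cast hT
  refine ENNReal.div_le_of_le_mul ?_
  rw [← ENNReal.ofReal_sum_of_nonneg fun t _ => hE t, ← ENNReal.ofReal_natCast,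
    ← ENNReal.ofReal_mul (div_nonneg (add_nonneg (hV 0) (abs_nonneg B)) hε.le)]
  refine ENNReal.ofReal_le_ofReal ?_
  rw [div_mul_eq_mul_div, le_div_iff₀ hε]
  have h1 := htel T
  have h2 := hV T
  have h3 : T * B ≤ T * |B| := mul_le_mul_of_nonneg_left (le_abs_self B) (by linarith)
  have h4 : V 0 ≤ V 0 * T := le_mul_of_one_le_right (hV 0) hT1
  linarith

lemma maxWeightRegion_subset_capacityRegion (channel : Fin N → Measure ℝ) :
    maxWeightRegion channel ⊆ capacityRegion channel := by
  rintro mu ⟨Ω, mΩ, P, hP, q₀, A, R, I, Q, hT, hI, hQ, -, hS⟩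
  exact ⟨Ω, mΩ, P, hP, q₀, A, R, I, Q, hT, hI, hQ, hS⟩

theorem dmwabStabilizes [∀ n, IsProbabilityMeasure (channel n)]
    (hK : ∀ n, ∀ᵐ r ∂(channel n), r ∈ Set.Icc 0 K) (hb : 1 < b)
    (hlam : StrictlyInside (capacityRegion channel) lam) :
    DMWABStabilizes.{u} (fun x : ℝ => b ^ x) channel lam := by
  intro Ω _ P _ q₀ A R X I Q hT hD hQ
  obtain ⟨mu, hmu, hlt⟩ := hlam
  obtain ⟨ε, hε, hgap⟩ : ∃ ε > 0, ∀ n, ε ≤ mu n - lam n := by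
    rcases isEmpty_or_nonempty (Fin N) with h | h
    · exact ⟨1, one_pos, fun n => h.elim n⟩
    · obtain ⟨n, hn⟩ := Finite.exists_min fun n => mu n - lam n
      exact ⟨_, sub_pos.2 (hlt n), hn⟩
  have hEnn : ∀ n t, 0 ≤ ∫ ω, Q n t ω ∂P := fun n t => integral_nonneg fun ω => hQ.nonneg n t ω
  unfold Stable
  simp only [lintegral_queue_eq hQ hT hD.isSchedule hK]
  refine limsup_lt_top_of_drift (V := fun t => ∑ n, ∫ ω, Q n t ω ^ 2 ∂P) (ε := 2 * ε)
    (by positivity) (fun t => Finset.sum_nonneg fun n _ => integral_nonneg fun ω => sq_nonneg _)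
    (fun t => Finset.sum_nonneg fun n _ => hEnn n t)
    fun t => le_trans ?_ (drift_bound hb hT hD hQ hK hmu t)
  rw [mul_assoc, Finset.mul_sum]
  gcongr with n _
  · exact hEnn n t
  · exact hgap n

end Wireless

theorem theorem1 {N : ℕ} (channel : Fin N → Measure ℝ) [∀ n, IsProbabilityMeasure (channel n)]
    (rates : Finset ℝ) (hrates : ∀ n, ∀ᵐ r ∂(channel n), r ∈ rates)
    (Rmin : ℝ) (hRmin : 0 < Rmin) (hchannel : ∀ n, ∀ᵐ r ∂(channel n), Rmin ≤ r)
    (b : ℝ) (hb : 1 < b) (lam : Fin N → ℝ) :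
    (Wireless.StrictlyInside (Wireless.capacityRegion channel) lam →
      Wireless.DMWABStabilizes.{u} (fun x : ℝ => b ^ x) channel lam) ∧
    (Wireless.StrictlyInside (Wireless.maxWeightRegion channel) lam →
      Wireless.DMWABStabilizes.{u} (fun x : ℝ => b ^ x) channel lam) := by
  obtain ⟨K, hK⟩ := rates.bddAbove
  have hIcc : ∀ n, ∀ᵐ r ∂(channel n), r ∈ Set.Icc 0 K := fun n => by
    filter_upwards [hrates n, hchannel n] with r h1 h2
    exact ⟨hRmin.le.trans h2, hK h1⟩
  refine ⟨fun h => Wireless.dmwabStabilizes hIcc hb h, fun h => ?_⟩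
  obtain ⟨mu, hmu, hlt⟩ := h
  exact Wireless.dmwabStabilizes hIcc hb
    ⟨mu, Wireless.maxWeightRegion_subset_capacityRegion channel hmu, hlt⟩
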